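/- Let $H$ be a complex Hilbert space and let $T$ be a bounded linear operator on $H$. Powers and logarithms of positive operators are understood in the sense of the continuous functional calculus, and $\le$ is the usual order of selfadjoint operators. Recall that $T$ is quasinormal if $T(T^*T)=(T^*T)T$; of class A if $T^*T\le (T^{*2}T^2)^{1/2}$; $p$-hyponormal, for a real number $p>0$, if $(TT^*)^p\le (T^*T)^p$; and log-hyponormal if $T$ is invertible and $\log (TT^*)\le \log (T^*T)$. Suppose that $T$ is of class A (in particular, this covers operators $T$ that are $p$-hyponormal for some $p>0$ or log-hyponormal). Then each of the following two conditions implies that $T$ is quasinormal: (i) $(T^{*n}T^n)^{1/n}=(T^{*k}T^k)^{1/k}$ for some positive integers $k,n$ with $k-n\ge 2$; (ii) $T^n$ is quasinormal for some positive integer $n$. -/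

import Mathlib

/-! Classes of bounded operators on a complex Hilbert space `H`. On `H →L[ℂ] H`, `star T` is the
Hilbert space adjoint, `*` is composition, `≤` is the Loewner order, and real powers of positive
operators and logarithms of positive invertible ones are taken in the continuous functional
calculus. -/

namespace HilbertOperator

variable {H : Type*} [NormedAddCommGroup H] [InnerProductSpace ℂ H] [CompleteSpace H]

/-- `T (T* T) = (T* T) T`. -/
def IsQuasinormal (T : H →L[ℂ] H) : Prop :=
  T * (star T * T) = (star T * T) * T

/-- `T* T ≤ (T*² T²)^{1/2}`. -/
def IsClassA (T : H →L[ℂ] H) : Prop :=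
  star T * T ≤ (star T ^ 2 * T ^ 2) ^ (1 / 2 : ℝ)

/-- `(T T*)^p ≤ (T* T)^p`, where `p` is a positive real number. -/
def IsPHyponormal (p : ℝ) (T : H →L[ℂ] H) : Prop :=
  0 < p ∧ (T * star T) ^ p ≤ (star T * T) ^ p

/-- `T` is invertible and `log (T T*) ≤ log (T* T)`. -/
def IsLogHyponormal (T : H →L[ℂ] H) : Prop :=
  IsUnit T ∧ CFC.log (T * star T) ≤ CFC.log (star T * T)

end HilbertOperator

/-! The proof takes place in a unital C⋆-algebra `A` with its usual order. For `t : A` put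
`Bₙ = t*ⁿ tⁿ` and `Aₙ = Bₙ^{1/n}`, so that `Bₙ₊₁ = t* Bₙ t` and class A reads `A₁ ≤ A₂`.

*Passing between `z z*` and `z* z`.* From `z f(z* z) = f(z z*) z` one gets, formally,
`(z* z)^{1-β} = z* (z z*)^{-β} z`. A bound on `(z z*)^β` therefore becomes a reversed bound on
`(z* z)^{1-β}`. As nothing is assumed invertible, inverses are replaced by resolvents
`s ↦ (s + δ)⁻¹` with `δ → 0`. The two directions are `rpow_one_sub_le_of_resolvent_le` and
`resolvent_le_rpow_one_sub`. Together with the Löwner–Heinz inequality the former gives Furuta's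
inequality (`furuta`) with a natural outer exponent: if `0 ≤ y ≤ x` and `p ≥ 1`, then
`(x^{r/2} y^p x^{r/2})^{(1+r)/(p+r)} ≤ x^{1+r}`.

*Hyponormality implies class A.* If `b^p ≤ a^p`, Furuta's inequality gives
`(a^{1/2} b a^{1/2})^{1/2} ≤ a`. The same conclusion holds if `log b ≤ log a`, because then
`b^p ≤ (s a)^p` for each `s > 1` and all small `p > 0`. With `a = t* t` and `b = t t*`, passing
from `z z*` to `z* z` for `z = a^{1/2} t` turns this into class A.

*Monotonicity.* Let `t` be of class A and `t* t ≤ x`. Furuta's inequality gives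
`(x^{n/2} t t* x^{n/2})^{1/(n+1)} ≤ x` (`rpow_conj_le_of_classA`), and passing from `z z*` to `z* z`
for `z = x^{n/2} t` gives `t* x^{n-1} t ≤ (t* xⁿ t)^{n/(n+1)}`. For `x = Aₙ` this is the inductive
step of `Bₙ ≤ Bₙ₊₁^{n/(n+1)}`, so `Aₙ` increases with `n`.

*Equality.* If `Aₙ = Aₖ` with `k ≥ n + 2`, then `Aₙ = Aₙ₊₁ = Aₙ₊₂ =: a`, so `t* aⁿ t = aⁿ⁺¹` and
`t* aⁿ⁺¹ t = aⁿ⁺²`. For `z = a^{n/2} t` and `q = (z z*)^{1/(n+1)} ≤ a` one has `q z = z a`, hence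
`z* (a - q) z = 0`. Positivity of `a - q` forces `(a - q) z = 0`, that is `a z = z a`. Together with
`t* t ≤ a` this yields `a t = t a` and `t* t = a`, which is quasinormality
(`quasinormal_of_star_mul_pow_mul`). If `tⁿ` is quasinormal, then `B₂ₙ = Bₙ²`, so `Aₙ = A₂ₙ`, and
for `n ≥ 2` the previous case applies. -/

namespace LoewnerOrder

open Set

variable {A : Type*} [CStarAlgebra A]

/-! ### Algebraic preliminaries -/

theorem mul_aeval_of_mul_eq {a b z : A} (h : z * a = b * z) (p : Polynomial ℝ) :
    z * Polynomial.aeval a p = Polynomial.aeval b p * z := by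
  induction p using Polynomial.induction_on' with
  | add p q hp hq => simp [mul_add, add_mul, hp, hq]
  | monomial n r =>
    have hn : z * a ^ n = b ^ n * z := (show SemiconjBy z a b from h).pow_right n
    rw [Polynomial.aeval_monomial, Polynomial.aeval_monomial, ← mul_assoc,
      ← Algebra.commutes r z, mul_assoc, hn, mul_assoc]

theorem mul_eq_zero_of_pow_mul_eq_zero {a y : A} (ha : IsSelfAdjoint a) {n : ℕ} (hn : 1 ≤ n)
    (h : a ^ n * y = 0) : a * y = 0 := by
  induction n, hn using Nat.le_induction with
  | base => simpa using h
  | succ n hn ih =>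
    apply ih
    obtain ⟨k, rfl⟩ := Nat.exists_eq_add_of_le' hn
    rw [← CStarRing.star_mul_self_eq_zero_iff, star_mul, (ha.pow _).star_eq]
    calc star y * a ^ (k + 1) * (a ^ (k + 1) * y)
        = star y * (a ^ (k + 1) * a ^ (k + 1)) * y := by simp only [mul_assoc]
      _ = star y * (a ^ k * a ^ (k + 1 + 1)) * y := by rw [← pow_add, ← pow_add]; congr 3; ring
      _ = star y * a ^ k * (a ^ (k + 1 + 1) * y) := by simp only [mul_assoc]
      _ = 0 := by rw [h, mul_zero]

theorem star_pow_succ_mul_pow_succ (t : A) (n : ℕ) :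
    star t ^ (n + 1) * t ^ (n + 1) = star t * (star t ^ n * t ^ n) * t := by
  rw [pow_succ', pow_succ]; simp only [mul_assoc]

theorem star_pow_two_mul_pow_two (t : A) :
    star t ^ 2 * t ^ 2 = star t * (star t * t) * t := by
  simp only [pow_two, mul_assoc]

variable [PartialOrder A] [StarOrderedRing A]

/-! ### Functional calculus of positive elements -/

theorem continuousOn_spectrum_of_nonneg {f : ℝ → ℝ} (hf : ContinuousOn f (Ici 0)) {a : A}
    (ha : 0 ≤ a) : ContinuousOn f (spectrum ℝ a) :=
  hf.mono fun _ hx => spectrum_nonneg_of_nonneg ha hx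

theorem continuousOn_rpow_Ici {x : ℝ} (hx : 0 ≤ x) : ContinuousOn (fun t : ℝ => t ^ x) (Ici 0) :=
  (Real.continuous_rpow_const hx).continuousOn

theorem continuousOn_resolvent {δ : ℝ} (hδ : 0 < δ) :
    ContinuousOn (fun t : ℝ => (t + δ)⁻¹) (Ici 0) :=
  ContinuousOn.inv₀ (by fun_prop) fun t (ht : 0 ≤ t) => by positivity

theorem continuousOn_resolvent_rpow {x δ : ℝ} (hx : 0 ≤ x) (hδ : 0 < δ) :
    ContinuousOn (fun t : ℝ => (t ^ x + δ)⁻¹) (Ici 0) :=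
  (continuousOn_resolvent hδ).comp (continuousOn_rpow_Ici hx)
    fun _ (ht : 0 ≤ _) => Real.rpow_nonneg ht x

/-- An element intertwining two positive elements intertwines continuous functions of them, by
uniform polynomial approximation on an interval that contains both spectra. -/
theorem mul_cfc_of_mul_eq {a b z : A} (ha : 0 ≤ a) (hb : 0 ≤ b) (h : z * a = b * z)
    {f : ℝ → ℝ} (hf : ContinuousOn f (Ici 0)) : z * cfc f a = cfc f b * z := by
  have approx : ∀ (q : Polynomial ℝ) (ε : ℝ), 0 < ε → ∀ c : A, 0 ≤ c →
      (∀ x ∈ Icc 0 (max ‖a‖ ‖b‖), |q.eval x - f x| < ε) → ‖c‖ ≤ max ‖a‖ ‖b‖ →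
      ‖cfc f c - Polynomial.aeval c q‖ ≤ ε := by
    intro q ε hε c hc hq hcn
    have hfc := continuousOn_spectrum_of_nonneg hf hc
    rcases subsingleton_or_nontrivial A with _ | _
    · simpa [Subsingleton.elim (cfc f c - Polynomial.aeval c q) 0] using hε.le
    rw [← cfc_polynomial q c, ← cfc_sub f q.eval c]
    refine norm_cfc_le hε.le fun x hx => ?_
    rw [norm_sub_rev, Real.norm_eq_abs]
    refine (hq x ⟨spectrum_nonneg_of_nonneg hc hx, ?_⟩).le
    exact (Real.le_norm_self x).trans ((spectrum.norm_le_norm_of_mem hx).trans hcn)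
  rw [← sub_eq_zero, ← norm_le_zero_iff]
  refine le_of_forall_pos_le_add fun ε hε => ?_
  rw [zero_add]
  obtain ⟨q, hq⟩ := exists_polynomial_near_of_continuousOn 0 (max ‖a‖ ‖b‖) f
    (hf.mono fun x hx => hx.1) (ε / (2 * (‖z‖ + 1))) (by positivity)
  have h1 := approx q _ (by positivity) a ha hq (le_max_left _ _)
  have h2 := approx q _ (by positivity) b hb hq (le_max_right _ _)
  have key : z * cfc f a - cfc f b * z =
      z * (cfc f a - Polynomial.aeval a q) - (cfc f b - Polynomial.aeval b q) * z := by
    rw [mul_sub, sub_mul, mul_aeval_of_mul_eq h]; abel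
  rw [key]
  calc _ ≤ ‖z‖ * (ε / (2 * (‖z‖ + 1))) + (ε / (2 * (‖z‖ + 1))) * ‖z‖ := by
        refine (norm_sub_le _ _).trans (add_le_add ?_ ?_)
        · exact (norm_mul_le _ _).trans (by gcongr)
        · exact (norm_mul_le _ _).trans (by gcongr)
    _ = ε * (‖z‖ / (‖z‖ + 1)) := by field_simp; ring
    _ ≤ ε := mul_le_of_le_one_right hε.le (by rw [div_le_one (by positivity)]; linarith)

theorem mul_cfc_star_mul_self (z : A) {f : ℝ → ℝ} (hf : ContinuousOn f (Ici 0)) :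
    z * cfc f (star z * z) = cfc f (z * star z) * z :=
  mul_cfc_of_mul_eq (star_mul_self_nonneg z) (mul_star_self_nonneg z) (mul_assoc z _ z).symm hf

theorem star_mul_cfc_mul (z : A) {f : ℝ → ℝ} (hf : ContinuousOn f (Ici 0)) :
    star z * cfc f (z * star z) * z = cfc (fun t => t * f t) (star z * z) := by
  have h0 := star_mul_self_nonneg z
  have hfc := continuousOn_spectrum_of_nonneg hf h0
  rw [mul_assoc, ← mul_cfc_star_mul_self z hf, ← mul_assoc,
    cfc_mul (fun t => t) f (star z * z), cfc_id' ℝ (star z * z)]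

theorem cfc_resolvent_antitone {a b : A} (ha : 0 ≤ a) (hab : a ≤ b) {δ : ℝ} (hδ : 0 < δ) :
    cfc (fun t : ℝ => (t + δ)⁻¹) b ≤ cfc (fun t : ℝ => (t + δ)⁻¹) a := by
  have key : ∀ c : A, 0 ≤ c →
      cfc (fun t : ℝ => (t + δ)⁻¹) c = Ring.inverse (c + algebraMap ℝ A δ) := by
    intro c hc
    have hne : ∀ x ∈ spectrum ℝ c, x + δ ≠ 0 := fun x hx => by
      have := spectrum_nonneg_of_nonneg hc hx
      positivity
    rw [cfc_inv (fun t : ℝ => t + δ) c hne, cfc_add_const δ (fun t => t) c, cfc_id' ℝ c]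
  rw [key a ha, key b (ha.trans hab)]
  refine CStarAlgebra.ringInverse_le_ringInverse (by gcongr) ?_
  exact IsStrictlyPositive.nonneg_add ha (isStrictlyPositive_algebraMap hδ)

theorem le_of_forall_pos_le_add_algebraMap {a b : A}
    (h : ∀ ε : ℝ, 0 < ε → a ≤ b + algebraMap ℝ A ε) : a ≤ b := by
  have hlim : Filter.Tendsto (fun ε : ℝ => b + algebraMap ℝ A ε - a)
      (nhdsWithin 0 (Ioi 0)) (nhds (b - a)) := by
    have : Continuous fun ε : ℝ => b + algebraMap ℝ A ε - a := by fun_prop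
    simpa using (this.tendsto 0).mono_left nhdsWithin_le_nhds
  refine sub_nonneg.1 (CStarAlgebra.isClosed_nonneg.mem_of_tendsto hlim ?_)
  filter_upwards [self_mem_nhdsWithin] with ε hε
  exact sub_nonneg.2 (h ε hε)

/-- For exponents `≥ 0` no invertibility is needed, because `0 ^ 0 = 1`. -/
theorem rpow_add_of_nonneg {a : A} (ha : 0 ≤ a) {x y : ℝ} (hx : 0 ≤ x) (hy : 0 ≤ y) :
    a ^ (x + y) = a ^ x * a ^ y := by
  have h1 := continuousOn_spectrum_of_nonneg (continuousOn_rpow_Ici hx) ha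
  have h2 := continuousOn_spectrum_of_nonneg (continuousOn_rpow_Ici hy) ha
  rw [CFC.rpow_eq_cfc_real, CFC.rpow_eq_cfc_real, CFC.rpow_eq_cfc_real, ← cfc_mul _ _ a]
  exact cfc_congr fun t ht =>
    Real.rpow_add_of_nonneg (spectrum_nonneg_of_nonneg ha ht) hx hy

theorem cfc_comp_rpow {a : A} (ha : 0 ≤ a) {x : ℝ} (hx : 0 ≤ x) {f : ℝ → ℝ}
    (hf : ContinuousOn f (Ici 0)) : cfc f (a ^ x) = cfc (fun t => f (t ^ x)) a := by
  have h1 := continuousOn_spectrum_of_nonneg (continuousOn_rpow_Ici hx) ha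
  have hm : ∀ t ∈ spectrum ℝ a, t ^ x ∈ Ici (0 : ℝ) := fun t ht =>
    Real.rpow_nonneg (spectrum_nonneg_of_nonneg ha ht) x
  rw [CFC.rpow_eq_cfc_real]
  exact (cfc_comp' f (fun t : ℝ => t ^ x) a (hf.mono (image_subset_iff.2 hm))).symm

theorem rpow_mul_cfc_mul_rpow {a : A} (ha : 0 ≤ a) {m x : ℝ} (hm : 0 ≤ m) (hx : 0 ≤ x)
    {f : ℝ → ℝ} (hf : ContinuousOn f (Ici 0)) :
    a ^ (m / 2) * cfc f (a ^ x) * a ^ (m / 2) = cfc (fun t => t ^ m * f (t ^ x)) a := by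
  have hm2 : 0 ≤ m / 2 := by positivity
  have h1 := continuousOn_spectrum_of_nonneg (continuousOn_rpow_Ici hm2) ha
  have hfx : ContinuousOn (fun t : ℝ => f (t ^ x)) (Ici 0) :=
    hf.comp (continuousOn_rpow_Ici hx) fun _ (ht : 0 ≤ _) => Real.rpow_nonneg ht x
  have h2 := continuousOn_spectrum_of_nonneg hfx ha
  have h3 : ContinuousOn (fun t : ℝ => t ^ (m / 2) * f (t ^ x)) (spectrum ℝ a) := h1.mul h2
  rw [cfc_comp_rpow ha hx hf, CFC.rpow_eq_cfc_real, ← cfc_mul _ _ a h1 h2, ← cfc_mul _ _ a h3 h1]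
  refine cfc_congr fun t ht => ?_
  have ht0 : 0 ≤ t := spectrum_nonneg_of_nonneg ha ht
  have : t ^ m = t ^ (m / 2) * t ^ (m / 2) := by
    rw [← Real.rpow_add_of_nonneg ht0 hm2 hm2, add_halves]
  simp only [this]; ring

theorem div_norm_add_one_smul_le {a : A} (ha : 0 ≤ a) {ε : ℝ} (hε : 0 < ε) :
    (ε / (‖a‖ + 1)) • a ≤ algebraMap ℝ A ε := by
  have h : 0 ≤ ε / (‖a‖ + 1) := by positivity
  calc (ε / (‖a‖ + 1)) • a ≤ (ε / (‖a‖ + 1)) • algebraMap ℝ A ‖a‖ :=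
        smul_le_smul_of_nonneg_left ha.isSelfAdjoint.le_algebraMap_norm_self h
    _ = algebraMap ℝ A (ε / (‖a‖ + 1) * ‖a‖) := by rw [map_mul, Algebra.smul_def]
    _ ≤ algebraMap ℝ A ε := by
        refine algebraMap_mono A ?_
        rw [div_mul_eq_mul_div, div_le_iff₀ (by positivity)]
        nlinarith

theorem rpow_half_mul_rpow_half {a : A} (ha : 0 ≤ a) {x : ℝ} (hx : 0 ≤ x) :
    a ^ (x / 2) * a ^ (x / 2) = a ^ x := by
  rw [← rpow_add_of_nonneg ha (by positivity) (by positivity), add_halves]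

theorem star_rpow (a : A) (x : ℝ) : star (a ^ x) = a ^ x :=
  (CFC.rpow_nonneg (a := a) (y := x)).isSelfAdjoint.star_eq

theorem rpow_mul_rpow_mul_rpow {a : A} (ha : 0 ≤ a) {x y : ℝ} (hx : 0 ≤ x) (hy : 0 ≤ y) :
    a ^ (x / 2) * a ^ y * a ^ (x / 2) = a ^ (x + y) := by
  have hx2 : 0 ≤ x / 2 := by positivity
  rw [← rpow_add_of_nonneg ha hx2 hy, ← rpow_add_of_nonneg ha (by positivity) hx2]
  congr 1; ring

/-! ### Passing between `z z*` and `z* z` -/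

/-- On `[0, M]` the functions `t / (t ^ β + δ)` approximate `t ^ (1 - β)` uniformly from below as
`δ → 0`. -/
theorem exists_rpow_one_sub_le {β : ℝ} (hβ0 : 0 ≤ β) (hβ1 : β < 1) (M : ℝ) {ε : ℝ} (hε : 0 < ε) :
    ∃ δ : ℝ, 0 < δ ∧ ∀ t : ℝ, 0 ≤ t → t ≤ M →
      t ^ (1 - β) ≤ t * (t ^ β + δ)⁻¹ + ε := by
  have h1β : 0 < 1 - β := by linarith
  -- Below the threshold `η` already `t ^ (1 - β) ≤ ε`; above it `t ^ β` dominates `δ`.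
  set η : ℝ := ε ^ (1 - β)⁻¹ with hη
  have hη0 : 0 < η := Real.rpow_pos_of_pos hε _
  have hηε : η ^ (1 - β) = ε := by
    rw [hη, ← Real.rpow_mul hε.le, inv_mul_cancel₀ h1β.ne', Real.rpow_one]
  have hM : 0 < (|M| + 1) ^ (1 - β) := Real.rpow_pos_of_pos (by positivity) _
  refine ⟨ε * η ^ β / (|M| + 1) ^ (1 - β), by positivity, fun t ht htM => ?_⟩
  set δ := ε * η ^ β / (|M| + 1) ^ (1 - β) with hδ
  have hδ0 : 0 < δ := by positivity
  have htβ : 0 ≤ t ^ β := Real.rpow_nonneg ht β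
  rcases le_or_gt t η with h | h
  · have : t ^ (1 - β) ≤ ε := hηε ▸ Real.rpow_le_rpow ht h h1β.le
    have h2 : 0 ≤ t * (t ^ β + δ)⁻¹ := by positivity
    linarith
  · have hmul : t ^ (1 - β) * t ^ β = t := by
      rw [← Real.rpow_add (hη0.trans h), sub_add_cancel, Real.rpow_one]
    have hle : t ^ (1 - β) * δ ≤ ε * t ^ β := by
      calc t ^ (1 - β) * δ ≤ (|M| + 1) ^ (1 - β) * δ := by
            gcongr
            exact htM.trans ((le_abs_self M).trans (by linarith))
        _ = ε * η ^ β := by rw [hδ]; field_simp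
        _ ≤ ε * t ^ β := by gcongr
    have hpos : 0 < t ^ β + δ := by positivity
    rw [← sub_le_iff_le_add, ← div_eq_mul_inv, le_div_iff₀ hpos]
    nlinarith

/-- Upper bounds for `(z* z)^{1-β} = z* (z z*)^{-β} z`: as `d ≤ (z z*)^β`, this is formally at
most `z* d⁻¹ z`, and the resolvents of `d` replace `d⁻¹`. -/
theorem rpow_one_sub_le_of_resolvent_le {z d e : A} {β : ℝ} (hβ0 : 0 ≤ β) (hβ1 : β < 1)
    (hd : 0 ≤ d) (hdz : d ≤ (z * star z) ^ β)
    (he : ∀ δ : ℝ, 0 < δ → star z * cfc (fun t : ℝ => (t + δ)⁻¹) d * z ≤ e) :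
    (star z * z) ^ (1 - β) ≤ e := by
  refine le_of_forall_pos_le_add_algebraMap fun ε hε => ?_
  obtain ⟨δ, hδ, hle⟩ := exists_rpow_one_sub_le hβ0 hβ1 ‖star z * z‖ hε
  have h0 := star_mul_self_nonneg z
  have hR := continuousOn_resolvent_rpow hβ0 hδ
  have hc1 : ContinuousOn (fun t : ℝ => t * (t ^ β + δ)⁻¹) (spectrum ℝ (star z * z)) :=
    continuousOn_id.mul (continuousOn_spectrum_of_nonneg hR h0)
  have hc2 := continuousOn_spectrum_of_nonneg (continuousOn_rpow_Ici (sub_nonneg.2 hβ1.le)) h0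
  rcases subsingleton_or_nontrivial A with _ | _
  · exact (Subsingleton.elim _ _).le
  calc (star z * z) ^ (1 - β)
      ≤ cfc (fun t : ℝ => t * (t ^ β + δ)⁻¹ + ε) (star z * z) := by
        rw [CFC.rpow_eq_cfc_real]
        refine cfc_mono (fun t ht => hle t (spectrum_nonneg_of_nonneg h0 ht) ?_) hc2
          (hc1.add continuousOn_const)
        exact (Real.le_norm_self t).trans (spectrum.norm_le_norm_of_mem ht)
    _ = star z * cfc (fun t : ℝ => (t + δ)⁻¹) ((z * star z) ^ β) * z + algebraMap ℝ A ε := by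
        rw [cfc_add_const ε _ (star z * z) hc1, ← star_mul_cfc_mul z hR,
          cfc_comp_rpow (mul_star_self_nonneg z) hβ0 (continuousOn_resolvent hδ)]
    _ ≤ star z * cfc (fun t : ℝ => (t + δ)⁻¹) d * z + algebraMap ℝ A ε := by
        gcongr ?_ + _
        exact star_left_conjugate_le_conjugate (cfc_resolvent_antitone hd hdz hδ) z
    _ ≤ e + algebraMap ℝ A ε := by
        gcongr
        exact he δ hδ

/-- Lower bounds for `(z* z)^{1-β} = z* (z z*)^{-β} z`: as `(z z*)^β ≤ x`, this is formally at
least `z* x⁻¹ z`. -/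
theorem resolvent_le_rpow_one_sub {z x : A} {β : ℝ} (hβ0 : 0 ≤ β) (hβ1 : β ≤ 1)
    (hzx : (z * star z) ^ β ≤ x) {δ : ℝ} (hδ : 0 < δ) :
    star z * cfc (fun t : ℝ => (t + δ)⁻¹) x * z ≤ (star z * z) ^ (1 - β) := by
  have h0 := star_mul_self_nonneg z
  have hR := continuousOn_resolvent_rpow hβ0 hδ
  have hc1 : ContinuousOn (fun t : ℝ => t * (t ^ β + δ)⁻¹) (spectrum ℝ (star z * z)) :=
    continuousOn_id.mul (continuousOn_spectrum_of_nonneg hR h0)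
  have hc2 := continuousOn_spectrum_of_nonneg (continuousOn_rpow_Ici (sub_nonneg.2 hβ1)) h0
  calc star z * cfc (fun t : ℝ => (t + δ)⁻¹) x * z
      ≤ star z * cfc (fun t : ℝ => (t + δ)⁻¹) ((z * star z) ^ β) * z :=
        star_left_conjugate_le_conjugate (cfc_resolvent_antitone CFC.rpow_nonneg hzx hδ) z
    _ = cfc (fun t : ℝ => t * (t ^ β + δ)⁻¹) (star z * z) := by
        rw [← star_mul_cfc_mul z hR,
          cfc_comp_rpow (mul_star_self_nonneg z) hβ0 (continuousOn_resolvent hδ)]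
    _ ≤ (star z * z) ^ (1 - β) := by
        rw [CFC.rpow_eq_cfc_real]
        refine cfc_mono (fun t ht => ?_) hc1 hc2
        have ht0 : 0 ≤ t := spectrum_nonneg_of_nonneg h0 ht
        have htβ : 0 ≤ t ^ β := Real.rpow_nonneg ht0 β
        have hmul : t ^ (1 - β) * t ^ β = t := by
          rw [← Real.rpow_add_of_nonneg ht0 (sub_nonneg.2 hβ1) hβ0, sub_add_cancel, Real.rpow_one]
        have : 0 ≤ t ^ (1 - β) := Real.rpow_nonneg ht0 _
        rw [← div_eq_mul_inv, div_le_iff₀ (by positivity)]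
        nlinarith

/-! ### Furuta's inequality -/

/-- Furuta's inequality for an outer exponent `s ∈ [0, 1]`. With `z = y^{m/2} x^{s/2}`,
Löwner–Heinz gives `y^{m-1} ≤ (z z*)^{(m-1)/(m+s)}`, and `z* y^{1-m} z = x^{s/2} y x^{s/2}`. -/
theorem furuta_of_le_one {x y : A} (hy : 0 ≤ y) (hyx : y ≤ x) {m s : ℝ} (hm : 1 ≤ m)
    (hs0 : 0 ≤ s) (hs1 : s ≤ 1) :
    (x ^ (s / 2) * y ^ m * x ^ (s / 2)) ^ ((1 + s) / (m + s)) ≤ x ^ (1 + s) := by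
  have hx : 0 ≤ x := hy.trans hyx
  have hm0 : 0 ≤ m := by linarith
  have hms : 0 < m + s := by linarith
  set z := y ^ (m / 2) * x ^ (s / 2) with hz
  have hsz : star z = x ^ (s / 2) * y ^ (m / 2) := by
    rw [hz, star_mul, star_rpow, star_rpow]
  have hzz : star z * z = x ^ (s / 2) * y ^ m * x ^ (s / 2) := by
    rw [hsz, hz, ← rpow_half_mul_rpow_half hy hm0]; simp only [mul_assoc]
  have hzz' : z * star z = y ^ (m / 2) * x ^ s * y ^ (m / 2) := by
    rw [hsz, hz, ← rpow_half_mul_rpow_half hx hs0]; simp only [mul_assoc]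
  have hexp : (1 + s) / (m + s) = 1 - (m - 1) / (m + s) := by field_simp; ring
  rw [hexp, ← hzz]
  have hβ0 : 0 ≤ (m - 1) / (m + s) := div_nonneg (by linarith) hms.le
  have hβ1 : (m - 1) / (m + s) < 1 := by rw [div_lt_one hms]; linarith
  refine rpow_one_sub_le_of_resolvent_le (d := y ^ (m - 1)) hβ0 hβ1 CFC.rpow_nonneg ?_ ?_
  · have h1 : y ^ (m - 1) = (y ^ (m + s)) ^ ((m - 1) / (m + s)) := by
      rw [CFC.rpow_rpow_of_exponent_nonneg y _ _ hms.le hβ0 hy]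
      congr 1; field_simp
    rw [h1, hzz', ← rpow_mul_rpow_mul_rpow hy hm0 hs0]
    refine CFC.rpow_le_rpow ⟨hβ0, hβ1.le⟩ ?_
    exact conjugate_le_conjugate_of_nonneg (CFC.rpow_le_rpow ⟨hs0, hs1⟩ hyx) CFC.rpow_nonneg
  · intro δ hδ
    have hm1 : 0 ≤ m - 1 := by linarith
    have hc : ContinuousOn (fun t : ℝ => t ^ m * (t ^ (m - 1) + δ)⁻¹) (spectrum ℝ y) :=
      continuousOn_spectrum_of_nonneg
        ((continuousOn_rpow_Ici hm0).mul (continuousOn_resolvent_rpow hm1 hδ)) hy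
    calc star z * cfc (fun t : ℝ => (t + δ)⁻¹) (y ^ (m - 1)) * z
        = x ^ (s / 2) * (y ^ (m / 2) * cfc (fun t : ℝ => (t + δ)⁻¹) (y ^ (m - 1)) *
            y ^ (m / 2)) * x ^ (s / 2) := by rw [hsz, hz]; simp only [mul_assoc]
      _ ≤ x ^ (s / 2) * x * x ^ (s / 2) := by
        refine conjugate_le_conjugate_of_nonneg (le_trans ?_ hyx) CFC.rpow_nonneg
        rw [rpow_mul_cfc_mul_rpow hy hm0 hm1 (continuousOn_resolvent hδ)]
        conv_rhs => rw [← cfc_id' ℝ y]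
        refine cfc_mono (fun t ht => ?_) hc continuousOn_id
        have ht0 : 0 ≤ t := spectrum_nonneg_of_nonneg hy ht
        have ht1 : 0 ≤ t ^ (m - 1) := Real.rpow_nonneg ht0 _
        have hmul : t ^ m = t ^ (m - 1) * t := by
          conv_rhs => rw [← Real.rpow_one t, ← Real.rpow_mul ht0, one_mul]
          rw [← Real.rpow_add_of_nonneg ht0 hm1 zero_le_one, sub_add_cancel]
        rw [← div_eq_mul_inv, div_le_iff₀ (by positivity), hmul]
        nlinarith
      _ = x ^ (1 + s) := by
        nth_rw 2 [← CFC.rpow_one x]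
        rw [rpow_mul_rpow_mul_rpow hx hs0 zero_le_one, add_comm]

/-- Furuta's inequality for a natural outer exponent `r`. The step from `r` to `r + 1` is
`furuta_of_le_one` for `x^{1+r}`, the left-hand side at `r`, and the outer exponent
`1 / (1 + r)`. -/
theorem furuta {x y : A} (hy : 0 ≤ y) (hyx : y ≤ x) {p : ℝ} (hp : 1 ≤ p) (r : ℕ) :
    (x ^ ((r : ℝ) / 2) * y ^ p * x ^ ((r : ℝ) / 2)) ^ ((1 + r) / (p + r)) ≤
      x ^ (1 + r : ℝ) := by
  have hx : 0 ≤ x := hy.trans hyx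
  have hp0 : 0 < p := by linarith
  induction r with
  | zero =>
    rw [Nat.cast_zero, zero_div, CFC.rpow_zero x, one_mul, mul_one, add_zero, add_zero,
      CFC.rpow_rpow_of_exponent_nonneg y _ _ hp0.le (by positivity), mul_one_div_cancel hp0.ne',
      CFC.rpow_one y, CFC.rpow_one x]
    exact hyx
  | succ r ih =>
    have hr : (0 : ℝ) ≤ r := Nat.cast_nonneg r
    have h1r : (0 : ℝ) < 1 + r := by linarith
    have hpr : 0 < p + r := by linarith
    have hnn : 0 ≤ x ^ ((r : ℝ) / 2) * y ^ p * x ^ ((r : ℝ) / 2) :=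
      conjugate_nonneg_of_nonneg CFC.rpow_nonneg CFC.rpow_nonneg
    have key := furuta_of_le_one (m := (p + r) / (1 + r)) (s := (1 + r : ℝ)⁻¹) CFC.rpow_nonneg ih
      (by rw [le_div_iff₀ h1r]; linarith) (by positivity)
      (inv_le_one_of_one_le₀ (by linarith))
    rw [CFC.rpow_rpow_of_exponent_nonneg _ _ _ (by positivity) (by positivity),
      CFC.rpow_rpow_of_exponent_nonneg _ _ _ (by positivity) (by positivity),
      CFC.rpow_rpow_of_exponent_nonneg _ _ _ (by positivity) (by positivity)] at key
    have e1 : (1 + r : ℝ) * ((1 + r : ℝ)⁻¹ / 2) = 1 / 2 := by field_simp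
    have e2 : (1 + r : ℝ) / (p + r) * ((p + r) / (1 + r)) = 1 := by field_simp
    have e3 : (1 + (1 + r : ℝ)⁻¹) / ((p + r) / (1 + r) + (1 + r : ℝ)⁻¹) =
        (1 + (r + 1 : ℕ)) / (p + (r + 1 : ℕ)) := by push_cast; field_simp; ring
    have e4 : (1 + r : ℝ) * (1 + (1 + r : ℝ)⁻¹) = 1 + (r + 1 : ℕ) := by
      push_cast; field_simp; ring
    rw [e1, e2, e3, e4, CFC.rpow_one _ hnn] at key
    have e5 : x ^ (((r + 1 : ℕ) : ℝ) / 2) = x ^ ((r : ℝ) / 2) * x ^ (1 / 2 : ℝ) := by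
      rw [← rpow_add_of_nonneg hx (by positivity) (by positivity)]
      congr 1; push_cast; ring
    have e6 : x ^ (((r + 1 : ℕ) : ℝ) / 2) = x ^ (1 / 2 : ℝ) * x ^ ((r : ℝ) / 2) := by
      rw [← rpow_add_of_nonneg hx (by positivity) (by positivity)]
      congr 1; push_cast; ring
    convert key using 2
    nth_rw 1 [e6]
    rw [e5]; simp only [mul_assoc]

/-! ### Comparison of powers or logarithms -/

/-- Comparing `p`-th powers implies the inequality `(a^{1/2} b a^{1/2})^{1/2} ≤ a`. After lowering
`p` to some `1 / m` with `m` a natural number, this is Furuta's inequality for `a^{1/m}` and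
`b^{1/m}` with both exponents equal to `m`. -/
theorem rpow_half_conj_le_of_rpow_le {a b : A} (ha : 0 ≤ a) (hb : 0 ≤ b) {p : ℝ} (hp : 0 < p)
    (h : b ^ p ≤ a ^ p) :
    (a ^ (1 / 2 : ℝ) * b * a ^ (1 / 2 : ℝ)) ^ (1 / 2 : ℝ) ≤ a := by
  obtain ⟨k, hk⟩ := exists_nat_one_div_lt hp
  set m : ℝ := k + 1 with hm
  have hm1 : 1 ≤ m := by rw [hm]; linarith [(Nat.cast_nonneg k : (0 : ℝ) ≤ k)]
  have hm0 : 0 < m := by linarith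
  have hexp : p * (1 / (m * p)) = 1 / m := by field_simp
  have h1 : b ^ (1 / m) ≤ a ^ (1 / m) := by
    have := CFC.rpow_le_rpow (p := 1 / (m * p)) ⟨by positivity, ?_⟩ h
    · rwa [CFC.rpow_rpow_of_exponent_nonneg _ _ _ hp.le (by positivity),
        CFC.rpow_rpow_of_exponent_nonneg _ _ _ hp.le (by positivity), hexp] at this
    · rw [div_lt_iff₀ hm0] at hk
      rw [div_le_one (by positivity)]; linarith
  have key := furuta CFC.rpow_nonneg h1 hm1 (k + 1)
  have hcast : ((k + 1 : ℕ) : ℝ) = m := by rw [hm]; push_cast; rfl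
  have e1 : 1 / m * (m / 2) = 1 / 2 := by field_simp
  have e2 : 1 / m * m = 1 := by field_simp
  rw [hcast, CFC.rpow_rpow_of_exponent_nonneg _ _ _ (by positivity) (by positivity),
    CFC.rpow_rpow_of_exponent_nonneg _ _ _ (by positivity) (by positivity),
    CFC.rpow_rpow_of_exponent_nonneg _ _ _ (by positivity) (by positivity), e1, e2,
    CFC.rpow_one b] at key
  have hnn : 0 ≤ a ^ (1 / 2 : ℝ) * b * a ^ (1 / 2 : ℝ) :=
    conjugate_nonneg_of_nonneg hb CFC.rpow_nonneg
  have key2 := CFC.rpow_le_rpow (p := m / (1 + m))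
    ⟨by positivity, by rw [div_le_one (by positivity)]; linarith⟩ key
  have e3 : (1 + m) / (m + m) * (m / (1 + m)) = 1 / 2 := by field_simp; norm_num
  have e4 : 1 / m * (1 + m) * (m / (1 + m)) = 1 := by field_simp
  rwa [CFC.rpow_rpow_of_exponent_nonneg _ _ _ (by positivity) (by positivity),
    CFC.rpow_rpow_of_exponent_nonneg _ _ _ (by positivity) (by positivity), e3, e4,
    CFC.rpow_one a] at key2

theorem smul_rpow_of_nonneg {a : A} (ha : 0 ≤ a) {r x : ℝ} (hr : 0 ≤ r) (hx : 0 ≤ x) :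
    (r • a) ^ x = r ^ x • a ^ x := by
  have h1 := continuousOn_spectrum_of_nonneg (continuousOn_rpow_Ici hx) ha
  rw [CFC.rpow_eq_cfc_real (smul_nonneg hr ha), CFC.rpow_eq_cfc_real, ← cfc_smul _ _ a h1]
  nth_rw 1 [← cfc_id' ℝ a]
  rw [← cfc_smul r (fun t => t) a,
    ← cfc_comp' (fun t : ℝ => t ^ x) (fun t => r • t) a
      (Real.continuous_rpow_const hx).continuousOn]
  exact cfc_congr fun t ht => Real.mul_rpow hr (spectrum_nonneg_of_nonneg ha ht)

theorem le_of_forall_one_lt_le_smul {a b : A} (ha : 0 ≤ a) (h : ∀ s : ℝ, 1 < s → b ≤ s • a) :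
    b ≤ a := by
  refine le_of_forall_pos_le_add_algebraMap fun ε hε => ?_
  have hs := h (1 + ε / (‖a‖ + 1)) (by simp; positivity)
  refine hs.trans ?_
  rw [add_smul, one_smul]
  gcongr
  exact div_norm_add_one_smul_le ha hε

theorem cfc_rpow_sub_one {a : A} (ha : IsStrictlyPositive a) (p : ℝ) :
    cfc (fun x : ℝ => p⁻¹ * (x ^ p - 1)) a = p⁻¹ • (a ^ p - 1) := by
  simp only [← smul_eq_mul]
  rw [cfc_smul _ (hf := by fun_prop (disch := grind)),
    cfc_sub _ _ (hf := by fun_prop (disch := grind)),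
    cfc_const_one .., CFC.rpow_eq_cfc_real ..]

/-- Since `(cᵖ - 1) / p → log c` in norm as `p → 0`, the strict gap
`log b + log s ≤ log (s a)` persists for powers with small exponents. -/
theorem exists_rpow_le_rpow_of_log_le {a b : A} (ha : IsStrictlyPositive a)
    (hb : IsStrictlyPositive b) (h : CFC.log b ≤ CFC.log a) {s : ℝ} (hs : 1 < s) :
    ∃ p : ℝ, 0 < p ∧ b ^ p ≤ (s • a) ^ p := by
  have hs0 : 0 < s := by linarith
  have hsa : IsStrictlyPositive (s • a) := IsStrictlyPositive.smul hs0 ha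
  have hlog : 0 < Real.log s := Real.log_pos hs
  have hlim := (CFC.tendsto_cfc_rpow_sub_one_log hsa).sub (CFC.tendsto_cfc_rpow_sub_one_log hb)
  have hev := (Metric.tendsto_nhds.1 hlim) (Real.log s) hlog
  obtain ⟨p, hp, hp0⟩ := (hev.and self_mem_nhdsWithin).exists
  refine ⟨p, hp0, ?_⟩
  have hp0' : 0 < p := hp0
  rw [cfc_rpow_sub_one hsa, cfc_rpow_sub_one hb, dist_eq_norm, CFC.log_smul' a hs0 ha,
    ← smul_sub] at hp
  set w := p⁻¹ • ((s • a) ^ p - 1 - (b ^ p - 1)) with hw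
  have hwsa : IsSelfAdjoint (w - (algebraMap ℝ A (Real.log s) + CFC.log a - CFC.log b)) := by
    have h1 : IsSelfAdjoint w := by
      refine IsSelfAdjoint.smul (IsSelfAdjoint.all _) ?_
      exact (CFC.rpow_nonneg.isSelfAdjoint.sub (.one A)).sub
        (CFC.rpow_nonneg.isSelfAdjoint.sub (.one A))
    exact h1.sub (((algebraMap_nonneg A hlog.le).isSelfAdjoint.add .log).sub .log)
  have h2 := hwsa.neg_algebraMap_norm_le_self
  have h3 : algebraMap ℝ A ‖w - (algebraMap ℝ A (Real.log s) + CFC.log a - CFC.log b)‖ ≤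
      algebraMap ℝ A (Real.log s) := algebraMap_mono A hp.le
  have h4 : 0 ≤ w := by
    have : w = (w - (algebraMap ℝ A (Real.log s) + CFC.log a - CFC.log b)) +
      algebraMap ℝ A (Real.log s) + (CFC.log a - CFC.log b) := by abel
    rw [this]
    refine add_nonneg ?_ (sub_nonneg.2 h)
    rw [← neg_le_iff_add_nonneg]
    exact (neg_le_neg h3).trans h2
  have h5 : 0 ≤ p • w := smul_nonneg hp0'.le h4
  rw [hw, smul_smul, mul_inv_cancel₀ hp0'.ne', one_smul, sub_sub_sub_cancel_right] at h5
  exact sub_nonneg.1 h5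

theorem rpow_half_conj_le_of_log_le {a b : A} (ha : IsStrictlyPositive a)
    (hb : IsStrictlyPositive b) (h : CFC.log b ≤ CFC.log a) :
    (a ^ (1 / 2 : ℝ) * b * a ^ (1 / 2 : ℝ)) ^ (1 / 2 : ℝ) ≤ a := by
  have ha0 := ha.nonneg
  have hb0 := hb.nonneg
  refine le_of_forall_one_lt_le_smul ha0 fun s hs => ?_
  have hs0 : 0 < s := by linarith
  obtain ⟨p, hp, hle⟩ := exists_rpow_le_rpow_of_log_le ha hb h (s := s ^ 2) (by nlinarith)
  have key := rpow_half_conj_le_of_rpow_le (smul_nonneg (by positivity) ha0) hb0 hp hle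
  have hsq : (s ^ 2) ^ (1 / 2 : ℝ) = s := by
    rw [← Real.sqrt_eq_rpow, Real.sqrt_sq hs0.le]
  have hnn : 0 ≤ a ^ (1 / 2 : ℝ) * b * a ^ (1 / 2 : ℝ) :=
    conjugate_nonneg_of_nonneg hb0 CFC.rpow_nonneg
  rw [smul_rpow_of_nonneg ha0 (by positivity) (by norm_num), hsq, smul_mul_assoc, smul_mul_assoc,
    mul_smul_comm, smul_smul, ← pow_two, smul_rpow_of_nonneg hnn (by positivity) (by norm_num),
    hsq] at key
  have := smul_le_smul_of_nonneg_left key (inv_nonneg.2 hs0.le)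
  rwa [smul_smul, smul_smul, inv_mul_cancel₀ hs0.ne', one_smul,
    show s⁻¹ * s ^ 2 = s by field_simp] at this

/-! ### Operators of class A -/

theorem rpow_mul_div_add_le {t p δ : ℝ} (ht : 0 ≤ t) (hp0 : 0 ≤ p) (hp1 : p ≤ 1) (hδ : 0 < δ) :
    t ^ p * (δ * (t + δ)⁻¹) ≤ δ ^ p := by
  have htδ : 0 < t + δ := by linarith
  calc t ^ p * (δ * (t + δ)⁻¹) ≤ (t + δ) ^ p * (δ * (t + δ)⁻¹) := by gcongr; linarith
    _ = (t + δ) ^ (p - 1) * δ := by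
        rw [Real.rpow_sub_one htδ.ne']; field_simp
    _ ≤ δ ^ (p - 1) * δ := by
        exact mul_le_mul_of_nonneg_right
          (Real.rpow_le_rpow_of_nonpos hδ (by linarith) (by linarith)) hδ.le
    _ = δ ^ p := by rw [Real.rpow_sub_one hδ.ne']; field_simp

/-- If `t t* ≤ c xᵖ`, then `t* δ(x + δ)⁻¹ t` has norm at most `c δᵖ`. In particular it tends to `0`
with `δ`, which says that the range of `t` is orthogonal to the kernel of `x`, quantitatively. -/
theorem star_mul_cfc_mul_le_algebraMap {t x : A} (hx : 0 ≤ x) {c p : ℝ} (hc : 0 ≤ c) (hp0 : 0 ≤ p)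
    (hp1 : p ≤ 1) (h : t * star t ≤ c • x ^ p) {δ : ℝ} (hδ : 0 < δ) :
    star t * cfc (fun s : ℝ => δ * (s + δ)⁻¹) x * t ≤ algebraMap ℝ A (c * δ ^ p) := by
  have hR : ContinuousOn (fun s : ℝ => δ * (s + δ)⁻¹) (Ici 0) :=
    continuousOn_const.mul (continuousOn_resolvent hδ)
  have hq := continuousOn_spectrum_of_nonneg (hR.sqrt) hx
  have hRs := continuousOn_spectrum_of_nonneg hR hx
  have hps := continuousOn_spectrum_of_nonneg (continuousOn_rpow_Ici hp0) hx
  -- `w² = δ(x + δ)⁻¹`, and `t* w² t` has the same norm as `w t t* w`.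
  set w := cfc (fun s : ℝ => √(δ * (s + δ)⁻¹)) x with hw
  have hw0 : 0 ≤ w := cfc_nonneg fun s _ => Real.sqrt_nonneg _
  have hsq : ∀ s ∈ spectrum ℝ x, √(δ * (s + δ)⁻¹) * √(δ * (s + δ)⁻¹) = δ * (s + δ)⁻¹ :=
    fun s hs => Real.mul_self_sqrt (by
      have := spectrum_nonneg_of_nonneg hx hs
      positivity)
  have hww : w * w = cfc (fun s : ℝ => δ * (s + δ)⁻¹) x := by
    rw [hw, ← cfc_mul _ _ x hq hq]
    exact cfc_congr hsq
  have hwxw : w * x ^ p * w = cfc (fun s : ℝ => s ^ p * (δ * (s + δ)⁻¹)) x := by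
    have h1 : ContinuousOn (fun s : ℝ => √(δ * (s + δ)⁻¹) * s ^ p) (spectrum ℝ x) := hq.mul hps
    rw [hw, CFC.rpow_eq_cfc_real, ← cfc_mul _ _ x hq hps, ← cfc_mul _ _ x h1 hq]
    refine cfc_congr fun s hs => ?_
    linear_combination s ^ p * hsq s hs
  have hle : w * (t * star t) * w ≤ algebraMap ℝ A (c * δ ^ p) :=
    calc w * (t * star t) * w ≤ w * (c • x ^ p) * w := conjugate_le_conjugate_of_nonneg h hw0
      _ = c • (w * x ^ p * w) := by rw [mul_smul_comm, smul_mul_assoc]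
      _ ≤ c • algebraMap ℝ A (δ ^ p) := by
        rw [hwxw]
        gcongr
        refine cfc_le_algebraMap _ _ x (fun s hs => ?_) (hps.mul hRs)
        exact rpow_mul_div_add_le (spectrum_nonneg_of_nonneg hx hs) hp0 hp1 hδ
      _ = algebraMap ℝ A (c * δ ^ p) := by rw [map_mul, Algebra.smul_def]
  have hnn : 0 ≤ c * δ ^ p := by positivity
  have hsw : star w = w := hw0.isSelfAdjoint.star_eq
  have e1 : star (w * t) * (w * t) = star t * cfc (fun s : ℝ => δ * (s + δ)⁻¹) x * t := by
    rw [star_mul, hsw, ← hww]; simp only [mul_assoc]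
  have e2 : (w * t) * star (w * t) = w * (t * star t) * w := by
    rw [star_mul, hsw]; simp only [mul_assoc]
  rw [← e1, ← CStarAlgebra.norm_le_iff_le_algebraMap _ hnn (star_mul_self_nonneg _),
    CStarRing.norm_star_mul_self, ← CStarRing.norm_self_mul_star, e2,
    CStarAlgebra.norm_le_iff_le_algebraMap _ hnn
      (conjugate_nonneg_of_nonneg (mul_star_self_nonneg t) hw0)]
  exact hle

theorem conj_resolvent_add_eq_one {x : A} (hx : 0 ≤ x) {δ : ℝ} (hδ : 0 < δ) :
    x ^ (1 / 2 : ℝ) * cfc (fun s : ℝ => (s + δ)⁻¹) x * x ^ (1 / 2 : ℝ) +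
      cfc (fun s : ℝ => δ * (s + δ)⁻¹) x = 1 := by
  have hRs := continuousOn_spectrum_of_nonneg (continuousOn_resolvent hδ) hx
  have h1 : ContinuousOn (fun s : ℝ => s ^ (1 : ℝ) * (s ^ (1 : ℝ) + δ)⁻¹) (spectrum ℝ x) := by
    simp only [Real.rpow_one]
    exact continuousOn_id.mul hRs
  have h2 : ContinuousOn (fun s : ℝ => δ * (s + δ)⁻¹) (spectrum ℝ x) := continuousOn_const.mul hRs
  have := rpow_mul_cfc_mul_rpow hx zero_le_one zero_le_one (continuousOn_resolvent hδ)
  rw [CFC.rpow_one x] at this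
  rw [this, ← cfc_add x _ _ h1 h2, ← cfc_const_one ℝ x]
  refine cfc_congr fun s hs => ?_
  have := spectrum_nonneg_of_nonneg hx hs
  have : s + δ ≠ 0 := by positivity
  simp only [Real.rpow_one]
  field_simp

/-- The inequality `(a^{1/2} b a^{1/2})^{1/2} ≤ a` for `a = t* t` and `b = t t*` implies class A as
soon as the kernel of `t` is contained in that of `t*`; the bound `h` ensures this. -/
theorem classA_of_rpow_half_conj_le {t : A} {c p : ℝ} (hc : 0 ≤ c) (hp0 : 0 < p) (hp1 : p ≤ 1)
    (h : t * star t ≤ c • (star t * t) ^ p)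
    (hx : ((star t * t) ^ (1 / 2 : ℝ) * (t * star t) * (star t * t) ^ (1 / 2 : ℝ)) ^ (1 / 2 : ℝ) ≤
      star t * t) :
    star t * t ≤ (star t * (star t * t) * t) ^ (1 / 2 : ℝ) := by
  have hnn := star_mul_self_nonneg t
  set x := star t * t with hxdef
  refine le_of_forall_pos_le_add_algebraMap fun ε hε => ?_
  obtain ⟨δ, hδ, hδε⟩ : ∃ δ : ℝ, 0 < δ ∧ c * δ ^ p ≤ ε := by
    refine ⟨(ε / (c + 1)) ^ p⁻¹, by positivity, ?_⟩
    rw [← Real.rpow_mul (by positivity), inv_mul_cancel₀ hp0.ne', Real.rpow_one,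
      mul_div_assoc', div_le_iff₀ (by positivity)]
    nlinarith
  have e1 : (x ^ (1 / 2 : ℝ) * t) * star (x ^ (1 / 2 : ℝ) * t) =
      x ^ (1 / 2 : ℝ) * (t * star t) * x ^ (1 / 2 : ℝ) := by
    rw [star_mul, star_rpow]; simp only [mul_assoc]
  have e2 : star (x ^ (1 / 2 : ℝ) * t) * (x ^ (1 / 2 : ℝ) * t) = star t * x * t := by
    conv_rhs => rw [← CFC.rpow_one x, ← rpow_half_mul_rpow_half hnn zero_le_one]
    rw [star_mul, star_rpow]; simp only [mul_assoc]
  have key := resolvent_le_rpow_one_sub (z := x ^ (1 / 2 : ℝ) * t) (β := 1 / 2) (by norm_num)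
    (by norm_num) (e1 ▸ hx) hδ
  rw [e2, show (1 - 1 / 2 : ℝ) = 1 / 2 by norm_num, star_mul, star_rpow] at key
  calc x = star t * (x ^ (1 / 2 : ℝ) * cfc (fun s : ℝ => (s + δ)⁻¹) x * x ^ (1 / 2 : ℝ) +
        cfc (fun s : ℝ => δ * (s + δ)⁻¹) x) * t := by
        rw [conj_resolvent_add_eq_one hnn hδ, mul_one]
    _ = star t * x ^ (1 / 2 : ℝ) * cfc (fun s : ℝ => (s + δ)⁻¹) x * (x ^ (1 / 2 : ℝ) * t) +
        star t * cfc (fun s : ℝ => δ * (s + δ)⁻¹) x * t := by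
        rw [mul_add, add_mul]; simp only [mul_assoc]
    _ ≤ (star t * x * t) ^ (1 / 2 : ℝ) + algebraMap ℝ A ε :=
        add_le_add key ((star_mul_cfc_mul_le_algebraMap hnn hc hp0.le hp1 h hδ).trans
          (algebraMap_mono A hδε))

/-- A converse to `classA_of_rpow_half_conj_le`, for any `x ≥ t* t` that satisfies the class A
inequality in place of the inner `t* t`. -/
theorem rpow_half_conj_le_of_classA {t x : A} (hx1 : star t * t ≤ x)
    (hx2 : star t * t ≤ (star t * x * t) ^ (1 / 2 : ℝ)) :
    (x ^ (1 / 2 : ℝ) * (t * star t) * x ^ (1 / 2 : ℝ)) ^ (1 / 2 : ℝ) ≤ x := by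
  have hx : 0 ≤ x := (star_mul_self_nonneg t).trans hx1
  have hxx : x ^ (1 / 2 : ℝ) * x ^ (1 / 2 : ℝ) = x := by
    rw [rpow_half_mul_rpow_half hx zero_le_one, CFC.rpow_one x]
  set z := star t * x ^ (1 / 2 : ℝ) with hz
  have hsz : star z = x ^ (1 / 2 : ℝ) * t := by rw [hz, star_mul, star_star, star_rpow]
  have e1 : star z * z = x ^ (1 / 2 : ℝ) * (t * star t) * x ^ (1 / 2 : ℝ) := by
    rw [hsz, hz]; simp only [mul_assoc]
  have e2 : z * star z = star t * x * t := by
    conv_rhs => rw [← hxx]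
    rw [hsz, hz]; simp only [mul_assoc]
  have h12 : (1 / 2 : ℝ) = 1 - 1 / 2 := by norm_num
  rw [← e1, h12]
  refine rpow_one_sub_le_of_resolvent_le (by norm_num) (by norm_num) (star_mul_self_nonneg t)
    (e2 ▸ hx2) fun δ hδ => ?_
  have hR := continuousOn_resolvent hδ
  have h0 := mul_star_self_nonneg t
  have := star_mul_cfc_mul (star t) hR
  rw [star_star] at this
  calc star z * cfc (fun s : ℝ => (s + δ)⁻¹) (star t * t) * z
      = x ^ (1 / 2 : ℝ) * (t * cfc (fun s : ℝ => (s + δ)⁻¹) (star t * t) * star t) *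
          x ^ (1 / 2 : ℝ) := by rw [hsz, hz]; simp only [mul_assoc]
    _ ≤ x ^ (1 / 2 : ℝ) * 1 * x ^ (1 / 2 : ℝ) := by
        refine conjugate_le_conjugate_of_nonneg ?_ CFC.rpow_nonneg
        rw [this]
        refine cfc_le_one _ _ fun s hs => ?_
        have := spectrum_nonneg_of_nonneg h0 hs
        rw [← div_eq_mul_inv, div_le_one (by positivity)]
        linarith
    _ = x := by rw [mul_one, hxx]

theorem rpow_conj_le_of_classA {t x : A} (hx1 : star t * t ≤ x)
    (hx2 : star t * t ≤ (star t * x * t) ^ (1 / 2 : ℝ)) {n : ℕ} (hn : 1 ≤ n) :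
    (x ^ ((n : ℝ) / 2) * (t * star t) * x ^ ((n : ℝ) / 2)) ^ (1 / ((n : ℝ) + 1)) ≤ x := by
  have hx : 0 ≤ x := (star_mul_self_nonneg t).trans hx1
  obtain ⟨r, rfl⟩ := Nat.exists_eq_add_of_le' hn
  have hnn : 0 ≤ x ^ (1 / 2 : ℝ) * (t * star t) * x ^ (1 / 2 : ℝ) :=
    conjugate_nonneg_of_nonneg (mul_star_self_nonneg t) CFC.rpow_nonneg
  have key := furuta CFC.rpow_nonneg (rpow_half_conj_le_of_classA hx1 hx2) one_le_two r
  rw [CFC.rpow_rpow_of_exponent_nonneg _ _ _ (by norm_num) (by norm_num),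
    show (1 / 2 : ℝ) * 2 = 1 by norm_num, CFC.rpow_one _ hnn] at key
  have e5 : x ^ (((r + 1 : ℕ) : ℝ) / 2) = x ^ ((r : ℝ) / 2) * x ^ (1 / 2 : ℝ) := by
    rw [← rpow_add_of_nonneg hx (by positivity) (by positivity)]
    congr 1; push_cast; ring
  have e6 : x ^ (((r + 1 : ℕ) : ℝ) / 2) = x ^ (1 / 2 : ℝ) * x ^ ((r : ℝ) / 2) := by
    rw [← rpow_add_of_nonneg hx (by positivity) (by positivity)]
    congr 1; push_cast; ring
  have e7 : x ^ ((r : ℝ) / 2) * (x ^ (1 / 2 : ℝ) * (t * star t) * x ^ (1 / 2 : ℝ)) *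
      x ^ ((r : ℝ) / 2) = x ^ (((r + 1 : ℕ) : ℝ) / 2) * (t * star t) *
        x ^ (((r + 1 : ℕ) : ℝ) / 2) := by
    nth_rw 2 [e6]
    rw [e5]; simp only [mul_assoc]
  have hnn2 : 0 ≤ x ^ (((r + 1 : ℕ) : ℝ) / 2) * (t * star t) * x ^ (((r + 1 : ℕ) : ℝ) / 2) :=
    conjugate_nonneg_of_nonneg (mul_star_self_nonneg t) CFC.rpow_nonneg
  have hr : (0 : ℝ) ≤ r := Nat.cast_nonneg r
  have key2 := CFC.rpow_le_rpow (p := 1 / (1 + r : ℝ))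
    ⟨by positivity, by rw [div_le_one (by positivity)]; linarith⟩ key
  rw [e7, CFC.rpow_rpow_of_exponent_nonneg _ _ _ (by positivity) (by positivity),
    CFC.rpow_rpow_of_exponent_nonneg _ _ _ (by positivity) (by positivity),
    mul_one_div_cancel (by positivity), CFC.rpow_one x] at key2
  convert key2 using 2
  push_cast; field_simp; ring

/-- Obtained from `rpow_conj_le_of_classA` by passing from `z z*` to `z* z` for
`z = x^{(n+1)/2} t`. Formally `z* x⁻¹ z = t* xⁿ t`. -/
theorem star_mul_pow_mul_le {t x : A} (hx1 : star t * t ≤ x)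
    (hx2 : star t * t ≤ (star t * x * t) ^ (1 / 2 : ℝ)) {n : ℕ} (hn : 1 ≤ n) :
    star t * x ^ n * t ≤ (star t * x ^ (n + 1) * t) ^ ((n + 1 : ℝ) / (n + 2)) := by
  have hx : 0 ≤ x := (star_mul_self_nonneg t).trans hx1
  obtain ⟨k, rfl⟩ := Nat.exists_eq_add_of_le' hn
  have h0 : 0 ≤ star t * x ^ k * t :=
    star_left_conjugate_nonneg (CStarAlgebra.pow_nonneg hx k) t
  set K := ‖star t * x ^ k * t‖ with hK
  refine le_of_forall_pos_le_add_algebraMap fun ε hε => ?_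
  set δ := ε / (K + 1) with hδdef
  have hδ : 0 < δ := by positivity
  set z := x ^ (((k + 1 + 1 : ℕ) : ℝ) / 2) * t with hz
  have hsz : star z = star t * x ^ (((k + 1 + 1 : ℕ) : ℝ) / 2) := by rw [hz, star_mul, star_rpow]
  have e1 : z * star z = x ^ (((k + 1 + 1 : ℕ) : ℝ) / 2) * (t * star t) *
      x ^ (((k + 1 + 1 : ℕ) : ℝ) / 2) := by rw [hsz, hz]; simp only [mul_assoc]
  have e2 : star z * z = star t * x ^ (k + 1 + 1) * t := by
    rw [← CFC.rpow_natCast x, ← rpow_half_mul_rpow_half hx (Nat.cast_nonneg _), hsz, hz]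
    simp only [mul_assoc]
  have h1 := rpow_conj_le_of_classA hx1 hx2 (n := k + 1 + 1) (by omega)
  have hk : (0 : ℝ) ≤ k := Nat.cast_nonneg k
  have key := resolvent_le_rpow_one_sub (z := z) (β := 1 / (((k + 1 + 1 : ℕ) : ℝ) + 1))
    (by positivity) (by rw [div_le_one (by positivity)]; push_cast; linarith) (e1 ▸ h1) hδ
  have hexp : 1 - 1 / (((k + 1 + 1 : ℕ) : ℝ) + 1) =
      (((k + 1 : ℕ) : ℝ) + 1) / ((k + 1 : ℕ) + 2) := by
    push_cast; field_simp; ring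
  rw [e2, hexp] at key
  have hR := continuousOn_spectrum_of_nonneg (continuousOn_resolvent hδ) hx
  have hcfc : x ^ (k + 1) ≤ x ^ (((k + 1 + 1 : ℕ) : ℝ) / 2) * cfc (fun s : ℝ => (s + δ)⁻¹) x *
      x ^ (((k + 1 + 1 : ℕ) : ℝ) / 2) + δ • x ^ k := by
    have h2 := rpow_mul_cfc_mul_rpow hx (m := ((k + 1 + 1 : ℕ) : ℝ)) (Nat.cast_nonneg _)
      zero_le_one (continuousOn_resolvent hδ)
    rw [CFC.rpow_one x] at h2
    simp only [Real.rpow_one, Real.rpow_natCast] at h2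
    have h3 : ContinuousOn (fun s : ℝ => s ^ (k + 1 + 1) * (s + δ)⁻¹) (spectrum ℝ x) :=
      (continuousOn_pow _).mul hR
    have h4 : ContinuousOn (fun s : ℝ => δ • s ^ k) (spectrum ℝ x) := by fun_prop
    rw [h2, ← cfc_pow_id (R := ℝ) x (k + 1), ← cfc_pow_id (R := ℝ) x k, ← cfc_smul δ _ x,
      ← cfc_add x _ _ h3 h4]
    refine cfc_mono (fun s hs => ?_) (by fun_prop) (h3.add h4)
    have hs0 := spectrum_nonneg_of_nonneg hx hs
    have hsk : 0 ≤ s ^ k := pow_nonneg hs0 k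
    have hsδ : 0 < s + δ := by positivity
    rw [smul_eq_mul, ← sub_le_iff_le_add, ← div_eq_mul_inv, le_div_iff₀ hsδ]
    ring_nf
    nlinarith [mul_nonneg (sq_nonneg δ) hsk]
  calc star t * x ^ (k + 1) * t
      ≤ star t * (x ^ (((k + 1 + 1 : ℕ) : ℝ) / 2) * cfc (fun s : ℝ => (s + δ)⁻¹) x *
          x ^ (((k + 1 + 1 : ℕ) : ℝ) / 2) + δ • x ^ k) * t :=
        star_left_conjugate_le_conjugate hcfc t
    _ = star z * cfc (fun s : ℝ => (s + δ)⁻¹) x * z + δ • (star t * x ^ k * t) := by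
        rw [mul_add, add_mul, hsz, hz, mul_smul_comm, smul_mul_assoc]; simp only [mul_assoc]
    _ ≤ _ := add_le_add key (div_norm_add_one_smul_le h0 hε)

/-! ### `p`-hyponormal and log-hyponormal elements are of class A -/

/-- A `p`-hyponormal element is of class A. -/
theorem classA_of_rpow_le {t : A} {p : ℝ} (hp : 0 < p)
    (h : (t * star t) ^ p ≤ (star t * t) ^ p) :
    star t * t ≤ (star t * (star t * t) * t) ^ (1 / 2 : ℝ) := by
  have hx := star_mul_self_nonneg t
  have hy := mul_star_self_nonneg t
  have hconj := rpow_half_conj_le_of_rpow_le hx hy hp h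
  -- For `r = min p 1` the element `t t*` is dominated by a multiple of `(t t*) ^ r`, and
  -- Löwner–Heinz lets `p` be lowered to `r`.
  set r := min p 1 with hr
  have hr0 : 0 < r := lt_min hp one_pos
  have hr1 : r ≤ 1 := min_le_right _ _
  have hle : (t * star t) ^ r ≤ (star t * t) ^ r := by
    have := CFC.rpow_le_rpow (p := r / p)
      ⟨by positivity, by rw [div_le_one hp]; exact min_le_left _ _⟩ h
    rwa [CFC.rpow_rpow_of_exponent_nonneg _ _ _ hp.le (by positivity),
      CFC.rpow_rpow_of_exponent_nonneg _ _ _ hp.le (by positivity),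
      mul_div_cancel₀ _ hp.ne'] at this
  have hbound : t * star t ≤ (‖t * star t‖ ^ (1 - r)) • (t * star t) ^ r := by
    have h1 := continuousOn_spectrum_of_nonneg (continuousOn_rpow_Ici hr0.le) hy
    have h2 : ContinuousOn (fun s : ℝ => ‖t * star t‖ ^ (1 - r) • s ^ r)
        (spectrum ℝ (t * star t)) := by
      simp only [smul_eq_mul]
      exact continuousOn_const.mul h1
    rcases subsingleton_or_nontrivial A with _ | _
    · exact (Subsingleton.elim _ _).le
    rw [CFC.rpow_eq_cfc_real, ← cfc_smul _ _ _ h1]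
    nth_rw 1 [← cfc_id' ℝ (t * star t)]
    refine cfc_mono (fun s hs => ?_) continuousOn_id h2
    have hs0 := spectrum_nonneg_of_nonneg hy hs
    have hs1 : s ≤ ‖t * star t‖ := (Real.le_norm_self s).trans (spectrum.norm_le_norm_of_mem hs)
    calc s = s ^ (1 - r) * s ^ r := by
          rw [← Real.rpow_add_of_nonneg hs0 (by linarith) hr0.le, sub_add_cancel, Real.rpow_one]
      _ ≤ ‖t * star t‖ ^ (1 - r) * s ^ r := by
          have := Real.rpow_nonneg hs0 r
          gcongr
  have hc : 0 ≤ ‖t * star t‖ ^ (1 - r) := Real.rpow_nonneg (norm_nonneg _) _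
  exact classA_of_rpow_half_conj_le hc hr0 hr1
    (hbound.trans (smul_le_smul_of_nonneg_left hle hc)) hconj

/-- A log-hyponormal element is of class A. -/
theorem classA_of_log_le {t : A} (ht : IsUnit t)
    (h : CFC.log (t * star t) ≤ CFC.log (star t * t)) :
    star t * t ≤ (star t * (star t * t) * t) ^ (1 / 2 : ℝ) := by
  rcases subsingleton_or_nontrivial A with _ | _
  · exact (Subsingleton.elim _ _).le
  have hx : IsStrictlyPositive (star t * t) :=
    (ht.star.mul ht).isStrictlyPositive (star_mul_self_nonneg t)
  have hy : IsStrictlyPositive (t * star t) :=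
    (ht.mul ht.star).isStrictlyPositive (mul_star_self_nonneg t)
  obtain ⟨r, hr, hrx⟩ := (CFC.exists_pos_algebraMap_le_iff hx.nonneg.isSelfAdjoint).2
    fun s hs => hx.spectrum_pos hs
  have hbound : t * star t ≤ (‖t * star t‖ / r) • (star t * t) ^ (1 : ℝ) := by
    rw [CFC.rpow_one _ hx.nonneg]
    calc t * star t ≤ algebraMap ℝ A ‖t * star t‖ :=
          hy.nonneg.isSelfAdjoint.le_algebraMap_norm_self
      _ = (‖t * star t‖ / r) • algebraMap ℝ A r := by
          rw [Algebra.smul_def, ← map_mul, div_mul_cancel₀ _ hr.ne']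
      _ ≤ (‖t * star t‖ / r) • (star t * t) := smul_le_smul_of_nonneg_left hrx (by positivity)
  exact classA_of_rpow_half_conj_le (by positivity) one_pos le_rfl hbound
    (rpow_half_conj_le_of_log_le hx hy h)

/-! ### Monotonicity of `n ↦ (t*ⁿ tⁿ)^{1/n}` -/

theorem star_pow_mul_pow_nonneg (t : A) (n : ℕ) : 0 ≤ star t ^ n * t ^ n := by
  rw [← star_pow]; exact star_mul_self_nonneg _

theorem rpow_one_div_pow {a : A} (ha : 0 ≤ a) (n m : ℕ) :
    (a ^ (1 / (n : ℝ))) ^ m = a ^ ((m : ℝ) / n) := by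
  rw [← CFC.rpow_natCast _ m,
    CFC.rpow_rpow_of_exponent_nonneg a _ _ (by positivity) (by positivity), one_div_mul_eq_div]

theorem rpow_one_div_pow_self {a : A} (ha : 0 ≤ a) {n : ℕ} (hn : 1 ≤ n) :
    (a ^ (1 / (n : ℝ))) ^ n = a := by
  rw [rpow_one_div_pow ha n n, div_self (by positivity), CFC.rpow_one a]

theorem star_mul_self_le_conj_of_le {t x : A}
    (h : star t * t ≤ (star t * (star t * t) * t) ^ (1 / 2 : ℝ)) (hx : star t * t ≤ x) :
    star t * t ≤ (star t * x * t) ^ (1 / 2 : ℝ) :=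
  h.trans (CFC.rpow_le_rpow ⟨by norm_num, by norm_num⟩ (star_left_conjugate_le_conjugate hx t))

/-- Both conjuncts are proved together: the second, `t* t ≤ x` for
`x = (t*ⁿ⁺¹ tⁿ⁺¹)^{1/(n+1)}`, is what makes `star_mul_pow_mul_le` applicable to `x`. -/
theorem star_pow_mul_pow_le {t : A}
    (h : star t * t ≤ (star t * (star t * t) * t) ^ (1 / 2 : ℝ)) {n : ℕ} (hn : 1 ≤ n) :
    star t ^ n * t ^ n ≤ (star t ^ (n + 1) * t ^ (n + 1)) ^ ((n : ℝ) / (n + 1 : ℕ)) ∧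
      star t * t ≤ (star t ^ (n + 1) * t ^ (n + 1)) ^ (1 / ((n + 1 : ℕ) : ℝ)) := by
  induction n, hn using Nat.le_induction with
  | base =>
    rw [pow_one, pow_one, star_pow_two_mul_pow_two]
    norm_num at h ⊢
    exact h
  | succ n hn ih =>
    have hB := star_pow_mul_pow_nonneg t (n + 1)
    set x := (star t ^ (n + 1) * t ^ (n + 1)) ^ (1 / ((n + 1 : ℕ) : ℝ)) with hx
    have hxn : x ^ n = (star t ^ (n + 1) * t ^ (n + 1)) ^ ((n : ℝ) / (n + 1 : ℕ)) :=
      rpow_one_div_pow hB (n + 1) n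
    have hxn1 : x ^ (n + 1) = star t ^ (n + 1) * t ^ (n + 1) :=
      rpow_one_div_pow_self hB (by omega)
    have key := star_mul_pow_mul_le ih.2 (star_mul_self_le_conj_of_le h ih.2) hn
    rw [hxn1, hxn, ← star_pow_succ_mul_pow_succ] at key
    have hfst : star t ^ (n + 1) * t ^ (n + 1) ≤
        (star t ^ (n + 1 + 1) * t ^ (n + 1 + 1)) ^ (((n + 1 : ℕ) : ℝ) / (n + 1 + 1 : ℕ)) := by
      rw [star_pow_succ_mul_pow_succ t n]
      refine (star_left_conjugate_le_conjugate ih.1 t).trans (key.trans_eq ?_)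
      congr 1; push_cast; ring
    refine ⟨hfst, ih.2.trans ?_⟩
    have := CFC.rpow_le_rpow (p := 1 / ((n + 1 : ℕ) : ℝ))
      ⟨by positivity, by
        rw [div_le_one (by positivity)]; push_cast; linarith [(Nat.cast_nonneg n : (0 : ℝ) ≤ n)]⟩
      hfst
    rw [CFC.rpow_rpow_of_exponent_nonneg _ _ _ (by positivity) (by positivity)
      (star_pow_mul_pow_nonneg t _)] at this
    refine this.trans_eq ?_
    congr 1; field_simp

theorem rpow_star_pow_mul_pow_le_succ {t : A}
    (h : star t * t ≤ (star t * (star t * t) * t) ^ (1 / 2 : ℝ)) {n : ℕ} (hn : 1 ≤ n) :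
    (star t ^ n * t ^ n) ^ (1 / (n : ℝ)) ≤
      (star t ^ (n + 1) * t ^ (n + 1)) ^ (1 / ((n + 1 : ℕ) : ℝ)) := by
  have h1 : (1 : ℝ) ≤ n := by exact_mod_cast hn
  have := CFC.rpow_le_rpow (p := 1 / (n : ℝ))
    ⟨by positivity, by rw [div_le_one (by positivity)]; exact h1⟩ (star_pow_mul_pow_le h hn).1
  rw [CFC.rpow_rpow_of_exponent_nonneg _ _ _ (by positivity) (by positivity)
    (star_pow_mul_pow_nonneg t _)] at this
  refine this.trans_eq ?_
  congr 1; field_simp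

theorem rpow_star_pow_mul_pow_mono {t : A}
    (h : star t * t ≤ (star t * (star t * t) * t) ^ (1 / 2 : ℝ)) {n m : ℕ} (hn : 1 ≤ n)
    (hnm : n ≤ m) :
    (star t ^ n * t ^ n) ^ (1 / (n : ℝ)) ≤ (star t ^ m * t ^ m) ^ (1 / (m : ℝ)) := by
  induction m, hnm using Nat.le_induction with
  | base => exact le_rfl
  | succ m hm ih => exact ih.trans (rpow_star_pow_mul_pow_le_succ h (hn.trans hm))

/-! ### The equality case -/

/-- `z* d z = (d^{1/2} z)* (d^{1/2} z)`. -/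
theorem mul_eq_zero_of_star_mul_mul_eq_zero {d z : A} (hd : 0 ≤ d) (h : star z * d * z = 0) :
    d * z = 0 := by
  have hs := CFC.sqrt_mul_sqrt_self d hd
  have hs0 : star (CFC.sqrt d) = CFC.sqrt d := (CFC.sqrt_nonneg d).isSelfAdjoint.star_eq
  have : CFC.sqrt d * z = 0 := by
    rw [← CStarRing.star_mul_self_eq_zero_iff, star_mul, hs0, ← h]
    nth_rw 3 [← hs]
    simp only [mul_assoc]
  rw [← hs, mul_assoc, this, mul_zero]

/-- The rigidity at the heart of the theorem. The element `z = a^{n/2} t` satisfies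
`(z z*)^{1/(n+1)} ≤ a` while both sides have the same compression by `z`, so `a` commutes with `z`.
Since `a` need not be injective, `a t = t a` and `t* t = a` are then extracted using `t* t ≤ a`. -/
theorem quasinormal_of_star_mul_pow_mul {t a : A} {n : ℕ} (hn : 1 ≤ n) (hta : star t * t ≤ a)
    (hconj : (a ^ ((n : ℝ) / 2) * (t * star t) * a ^ ((n : ℝ) / 2)) ^ (1 / ((n : ℝ) + 1)) ≤ a)
    (h1 : star t * a ^ n * t = a ^ (n + 1)) (h2 : star t * a ^ (n + 1) * t = a ^ (n + 2)) :
    t * (star t * t) = star t * t * t := by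
  have ha : 0 ≤ a := (star_mul_self_nonneg t).trans hta
  have hsa : star a = a := ha.isSelfAdjoint.star_eq
  have hn0 : (0 : ℝ) ≤ n := Nat.cast_nonneg n
  set b := a ^ ((n : ℝ) / 2) with hb
  have hbb : b * b = a ^ n := by rw [rpow_half_mul_rpow_half ha hn0, CFC.rpow_natCast a]
  have hba : b * a = a * b := by
    rw [hb]; nth_rw 2 3 [← CFC.rpow_one a]
    rw [← rpow_add_of_nonneg ha (by positivity) zero_le_one,
      ← rpow_add_of_nonneg ha zero_le_one (by positivity), add_comm]
  have hsb : star b = b := star_rpow _ _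
  set z := b * t with hz
  have hzz : star z * z = a ^ (n + 1) := by
    rw [← h1, ← hbb, hz, star_mul, hsb]; simp only [mul_assoc]
  have hzz' : z * star z = b * (t * star t) * b := by
    rw [hz, star_mul, hsb]; simp only [mul_assoc]
  set q := (b * (t * star t) * b) ^ (1 / ((n : ℝ) + 1)) with hq
  have hqz : q * z = z * a := by
    have he : (0 : ℝ) ≤ 1 / ((n : ℝ) + 1) := by positivity
    have := mul_cfc_star_mul_self z (continuousOn_rpow_Ici he)
    rw [← CFC.rpow_eq_cfc_real (star_mul_self_nonneg z),
      ← CFC.rpow_eq_cfc_real (mul_star_self_nonneg z), hzz, hzz', ← CFC.rpow_natCast a,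
      CFC.rpow_rpow_of_exponent_nonneg a _ _ (Nat.cast_nonneg _) he, Nat.cast_succ,
      mul_one_div_cancel (by positivity), CFC.rpow_one a] at this
    exact this.symm
  have hd : star z * (a - q) * z = 0 := by
    have e1 : star z * a * z = a ^ (n + 2) := by
      calc star z * a * z = star t * (b * a * b) * t := by
            rw [hz, star_mul, hsb]; simp only [mul_assoc]
        _ = a ^ (n + 2) := by rw [hba, mul_assoc a, hbb, ← pow_succ', h2]
    have e2 : star z * q * z = a ^ (n + 2) := by
      rw [mul_assoc, hqz, ← mul_assoc, hzz, ← pow_succ]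
    rw [mul_sub, sub_mul, e1, e2, sub_self]
  have haz : a * z = z * a := by
    have := mul_eq_zero_of_star_mul_mul_eq_zero (sub_nonneg.2 hconj) hd
    rw [sub_mul, hqz] at this
    exact sub_eq_zero.1 this
  -- From here on `a` is cancelled only up to its kernel.
  have hcomm_n : a ^ n * (a * t - t * a) = 0 := by
    have e : b * (a * t - t * a) = 0 := by
      rw [mul_sub, ← mul_assoc, hba, mul_assoc, ← mul_assoc b t a, ← hz, haz, sub_self]
    rw [← hbb, mul_assoc, e, mul_zero]
  have hcomm : a * (a * t - t * a) = 0 :=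
    mul_eq_zero_of_pow_mul_eq_zero ha.isSelfAdjoint hn hcomm_n
  have haat : a * a * t = a * t * a := by
    rw [mul_sub, sub_eq_zero] at hcomm
    simpa only [mul_assoc] using hcomm
  have hpow : ∀ k : ℕ, a ^ (k + 1) * t = a * t * a ^ k := by
    intro k
    induction k with
    | zero => simp
    | succ k ih =>
      rw [pow_succ', mul_assoc, ih, ← mul_assoc, ← mul_assoc, haat, pow_succ']
      simp only [mul_assoc]
  have hata : a * (star t * a * t - a * a) = 0 := by
    obtain ⟨k, rfl⟩ := Nat.exists_eq_add_of_le' hn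
    have e : (star t * a * t - a * a) * a ^ k = 0 := by
      rw [sub_mul, sub_eq_zero, mul_assoc _ t, mul_assoc _ a, ← mul_assoc a t, ← hpow, ← mul_assoc,
        h1, mul_assoc, ← pow_succ', ← pow_succ']
    have hstar : star (star t * a * t - a * a) = star t * a * t - a * a := by
      simp only [star_sub, star_mul, star_star, hsa, mul_assoc]
    have e' : a ^ (k + 1) * (star t * a * t - a * a) = 0 := by
      have := congrArg star e
      rw [star_mul, hstar, star_pow, hsa, star_zero] at this
      rw [pow_succ', mul_assoc, this, mul_zero]
    exact mul_eq_zero_of_pow_mul_eq_zero ha.isSelfAdjoint (by omega) e'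
  have hata' : a * star t * a * t = a * a * a := by
    rw [mul_sub, sub_eq_zero] at hata
    simpa only [mul_assoc] using hata
  have hat : a * t = t * a := by
    rw [← sub_eq_zero, ← CStarRing.star_mul_self_eq_zero_iff]
    refine le_antisymm ?_ (star_mul_self_nonneg _)
    -- All four terms are known up to `t* t ≤ a`, and they add up to at most `0`.
    have e : star (a * t - t * a) * (a * t - t * a) = a * (star t * t) * a - a * a * a := by
      rw [star_sub, star_mul, star_mul, hsa, sub_mul, mul_sub, mul_sub]
      have e1 : star t * a * (a * t) = star t * a * (t * a) := by
        calc star t * a * (a * t) = star t * (a * a * t) := by simp only [mul_assoc]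
          _ = star t * a * (t * a) := by rw [haat]; simp only [mul_assoc]
      have e2 : a * star t * (a * t) = a * a * a := by rw [← hata']; simp only [mul_assoc]
      rw [e1, e2, sub_self]
      simp only [mul_assoc]
      abel
    rw [e, sub_nonpos]
    exact conjugate_le_conjugate_of_nonneg hta ha
  have htta : star t * t = a := by
    have hc : Commute a t := hat
    have e0 : a ^ n * (a - star t * t) = 0 := by
      have e1 : (a - star t * t) * a ^ n = 0 := by
        rw [sub_mul, ← pow_succ', ← h1, mul_assoc, mul_assoc, (hc.pow_left n).eq, sub_self]
      have := congrArg star e1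
      simpa only [star_mul, star_sub, star_pow, star_star, hsa, star_zero] using this
    have e1 := mul_eq_zero_of_pow_mul_eq_zero ha.isSelfAdjoint hn e0
    have hp0 : 0 ≤ a - star t * t := sub_nonneg.2 hta
    have hpa : a - star t * t ≤ a := sub_le_self _ (star_mul_self_nonneg t)
    set p := a - star t * t with hp
    -- `0 ≤ p ≤ a` and `a p = 0` give `p³ ≤ p a p = 0`.
    have e2 : p ^ 3 = 0 := by
      refine le_antisymm ?_ (CStarAlgebra.pow_nonneg hp0 3)
      calc p ^ 3 = p * p * p := by rw [pow_succ, pow_two]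
        _ ≤ p * a * p := conjugate_le_conjugate_of_nonneg hpa hp0
        _ = 0 := by rw [mul_assoc, e1, mul_zero]
    have e3 := mul_eq_zero_of_pow_mul_eq_zero hp0.isSelfAdjoint (n := 3) (y := 1) (by norm_num)
      (by rw [e2, zero_mul])
    rw [mul_one] at e3
    exact (sub_eq_zero.1 e3).symm
  rw [htta, hat]

theorem quasinormal_of_rpow_star_pow_mul_pow_eq {t : A}
    (h : star t * t ≤ (star t * (star t * t) * t) ^ (1 / 2 : ℝ)) {n k : ℕ} (hn : 1 ≤ n)
    (hnk : n + 2 ≤ k)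
    (heq : (star t ^ n * t ^ n) ^ (1 / (n : ℝ)) = (star t ^ k * t ^ k) ^ (1 / (k : ℝ))) :
    t * (star t * t) = star t * t * t := by
  set a := (star t ^ n * t ^ n) ^ (1 / (n : ℝ)) with ha
  have hpow : ∀ m, n ≤ m → m ≤ k → a ^ m = star t ^ m * t ^ m := by
    intro m hnm hmk
    have h1 : a = (star t ^ m * t ^ m) ^ (1 / (m : ℝ)) :=
      le_antisymm (rpow_star_pow_mul_pow_mono h hn hnm)
        ((rpow_star_pow_mul_pow_mono h (hn.trans hnm) hmk).trans_eq heq.symm)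
    rw [h1, rpow_one_div_pow_self (star_pow_mul_pow_nonneg t m) (hn.trans hnm)]
  have hta : star t * t ≤ a := by
    have := rpow_star_pow_mul_pow_mono h le_rfl hn
    rwa [Nat.cast_one, div_one, pow_one, pow_one, CFC.rpow_one _ (star_mul_self_nonneg t)] at this
  refine quasinormal_of_star_mul_pow_mul hn hta
    (rpow_conj_le_of_classA hta (star_mul_self_le_conj_of_le h hta) hn) ?_ ?_
  · rw [hpow n le_rfl (by omega), hpow (n + 1) (by omega) (by omega), star_pow_succ_mul_pow_succ]
  · rw [hpow (n + 1) (by omega) (by omega), hpow (n + 2) (by omega) hnk,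
      star_pow_succ_mul_pow_succ t (n + 1)]

end LoewnerOrder

open LoewnerOrder in
theorem mainTheorem5 {H : Type*} [NormedAddCommGroup H] [InnerProductSpace ℂ H] [CompleteSpace H]
    (T : H →L[ℂ] H)
    (hT : HilbertOperator.IsClassA T ∨ (∃ p : ℝ, HilbertOperator.IsPHyponormal p T) ∨
      HilbertOperator.IsLogHyponormal T) :
    ((∃ k n : ℕ, 0 < n ∧ 0 < k ∧ n + 2 ≤ k ∧
        (star T ^ n * T ^ n) ^ (1 / (n : ℝ)) = (star T ^ k * T ^ k) ^ (1 / (k : ℝ))) →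
      HilbertOperator.IsQuasinormal T) ∧
    ((∃ n : ℕ, 0 < n ∧ HilbertOperator.IsQuasinormal (T ^ n)) →
      HilbertOperator.IsQuasinormal T) := by
  have hA : star T * T ≤ (star T * (star T * T) * T) ^ (1 / 2 : ℝ) := by
    rcases hT with h | ⟨p, hp, h⟩ | ⟨hu, h⟩
    · rw [← star_pow_two_mul_pow_two]; exact h
    · exact classA_of_rpow_le hp h
    · exact classA_of_log_le hu h
  refine ⟨fun ⟨k, n, hn, _, hnk, heq⟩ => quasinormal_of_rpow_star_pow_mul_pow_eq hA hn hnk heq,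
    fun ⟨n, hn, hq⟩ => ?_⟩
  obtain rfl | hn2 : n = 1 ∨ 2 ≤ n := by omega
  · simpa using hq
  refine quasinormal_of_rpow_star_pow_mul_pow_eq hA hn (k := n + n) (by omega) ?_
  have hq' : T ^ n * (star T ^ n * T ^ n) = star T ^ n * T ^ n * T ^ n := by
    simpa only [HilbertOperator.IsQuasinormal, star_pow] using hq
  have hsq : star T ^ (n + n) * T ^ (n + n) = (star T ^ n * T ^ n) ^ (2 : ℝ) := by
    rw [show (2 : ℝ) = (2 : ℕ) by norm_num,
      CFC.rpow_natCast _ _ (star_pow_mul_pow_nonneg T n), pow_two, pow_add, pow_add,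
      mul_assoc (star T ^ n) (T ^ n), hq']
    simp only [mul_assoc]
  rw [hsq, CFC.rpow_rpow_of_exponent_nonneg _ _ _ (by norm_num) (by positivity)
    (star_pow_mul_pow_nonneg T n)]
  congr 1
  push_cast
  field_simp
  norm_num
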